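/- **Proposition 2.5 (Correspondence with the nonmagnetic case).** Let $\mathfrak H^n$ be the space of antisymmetric functions in $L^2((\mathbb R^3)^n;\mathbb C)$, with $\mathfrak H^0=\mathbb C$. Let $\mathcal D$ be the set of $H^1$-regular block-diagonal Fock space states, i.e. of sequences $\mathbf\Gamma=\Gamma_0\oplus\Gamma_1\oplus\cdots$ of non-negative trace class operators $\Gamma_n$ on $\mathfrak H^n$ which have a spectral decomposition $\Gamma_n=\sum_j\mu_j^{(n)}|\Psi_j^{(n)}\rangle\langle\Psi_j^{(n)}|$ with $\mu_j^{(n)}\ge 0$ and $L^2$-orthonormal $\Psi_j^{(n)}\in\mathfrak H^n\cap H^1(\mathbb R^{3n})$, such that $\sum_{n\ge0}\operatorname{Tr}\Gamma_n=1$ and $\sum_{n\ge0}\sum_j\mu_j^{(n)}\|\nabla\Psi_j^{(n)}\|^2<\infty$. For a non-negative quadratic form $\mathcal A$ on $\mathfrak H^n\cap H^1(\mathbb R^{3n})$ with associated operator $A$, put $\operatorname{Tr}_{\mathfrak H^n}A\Gamma_n:=\sum_j\mu_j^{(n)}\mathcal A(\Psi_j^{(n)})\in[0,\infty]$. The density and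 the paramagnetic current density of $\mathbf\Gamma$ are $$\rho_{\mathbf\Gamma}(x)=\sum_{n\ge1}\sum_j\mu^{(n)}_j\,n\int_{(\mathbb R^3)^{n-1}}|\Psi^{(n)}_j(x,x_2,\dots,x_n)|^2\,dx_2\cdots dx_n,$$ $$\mathbf j^{\mathrm p}_{\mathbf\Gamma}(x)=\sum_{n\ge1}\sum_j\mu^{(n)}_j\,n\int_{(\mathbb R^3)^{n-1}}\operatorname{Im}\Bigl(\nabla_{x}\Psi^{(n)}_j\,\overline{\Psi^{(n)}_j}\Bigr)(x,x_2,\dots,x_n)\,dx_2\cdots dx_n .$$ For $\rho:\mathbb R^3\to\mathbb R$ and $\mathbf j:\mathbb R^3\to\mathbb R^3$ define (equalities of densities and currents being almost everywhere, and $\inf\emptyset=+\infty$) $$F(\rho,\mathbf j)=\inf_{\substack{\mathbf\Gamma\in\mathcal D\\ \rho_{\mathbf\Gamma}=\rho,\ \mathbf j^{\mathrm p}_{\mathbf\Gamma}=\mathbf j}}\ \sum_{n\ge1}\operatorname{Tr}_{\mathfrak H^n}\Bigl(-\sum_{1\le i\le n}\Delta_{x_i}+\sum_{1\le i<k\le n}\frac1{|x_i-x_k|}\Bigr)\Gamma_n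 ,$$ and let $T(\rho,\mathbf j)$ be the same infimum without the Coulomb term. Let $F(\rho)$ and $T(\rho)$ be the corresponding infima over all $\mathbf\Gamma\in\mathcal D$ with $\rho_{\mathbf\Gamma}=\rho$, without any constraint on $\mathbf j^{\mathrm p}_{\mathbf\Gamma}$. With $D(\rho)=\frac12\iint_{\mathbb R^3\times\mathbb R^3}\frac{\rho(x)\rho(y)}{|x-y|}\,dx\,dy$, put $$E(\rho,\mathbf j)=F(\rho,\mathbf j)-D(\rho),\quad E(\rho)=F(\rho)-D(\rho),\quad E^{\mathrm{xc}}(\rho,\mathbf j)=E(\rho,\mathbf j)-T(\rho,\mathbf j),\quad E^{\mathrm{xc}}(\rho)=E(\rho)-T(\rho).$$ Let $\mathcal I=\{\rho\in L^1(\mathbb R^3;\mathbb R_+):\nabla\sqrt\rho\in L^2(\mathbb R^3)^3\}$. Then for every $\rho\in\mathcal I$, $$T(\rho,0)=T(\rho)\quad\text{and}\quad F(\rho,0)=F(\rho),$$ and in particular $$E(\rho,0)=E(\rho)\quad\text{and}\quad E^{\mathrm{xc}}(\rho,0)=E^{\mathrm{xc}}(\rho).$$ -/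

import Mathlib

open MeasureTheory
open scoped ENNReal NNReal

noncomputable section

namespace CurrentDFT

/-- Physical space `ℝ³`. -/
abbrev Space : Type := EuclideanSpace ℝ (Fin 3)

/-- Configuration space `(ℝ³)ⁿ`, with product Lebesgue measure (a Dirac mass if `n = 0`). -/
abbrev Config (n : ℕ) : Type := Fin n → Space

/-- `L²((ℝ³)ⁿ; ℂ)`. -/
abbrev L2 (n : ℕ) : Type := Lp ℂ 2 (volume : Measure (Config n))

/-- `g` is the weak (distributional) derivative of `u` in the direction `v`, tested against real
test functions. It is only used for `u` and `g` in `L²`, so that the integrals converge. -/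
def HasWeakDeriv {E F : Type*} [NormedAddCommGroup E] [NormedSpace ℝ E] [MeasureSpace E]
    [NormedAddCommGroup F] [NormedSpace ℝ F] (u g : E → F) (v : E) : Prop :=
  ∀ φ : E → ℝ, ContDiff ℝ (⊤ : ℕ∞) φ → HasCompactSupport φ →
    ∫ x, (fderiv ℝ φ x v) • u x = - ∫ x, φ x • g x

/-- The set `𝓘` of densities: `ρ ∈ L¹(ℝ³; ℝ₊)` with `∇√ρ ∈ L²(ℝ³)³`. -/
def densities : Set (Space → ℝ) :=
  {ρ | Integrable ρ ∧ 0 ≤ᵐ[volume] ρ ∧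
    ∀ a : Fin 3, ∃ g : Space → ℝ, MemLp g 2 volume ∧
      HasWeakDeriv (fun x => √(ρ x)) g (EuclideanSpace.single a 1)}

/-! ### Fermionic wave functions -/

/-- Almost everywhere equality is stable under permuting the particles. -/
theorem ae_eq_comp_perm {n : ℕ} (σ : Equiv.Perm (Fin n)) {f g : Config n → ℂ}
    (h : f =ᵐ[volume] g) : ∀ᵐ X : Config n, f (X ∘ σ) = g (X ∘ σ) := by
  have h1 := (volume_measurePreserving_piCongrLeft (fun _ : Fin n => Space)
    σ.symm).quasiMeasurePreserving.ae_eq_comp h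
  filter_upwards [h1] with X hX
  have e : (MeasurableEquiv.piCongrLeft (fun _ : Fin n => Space) σ.symm) X = X ∘ σ := by
    funext i
    obtain ⟨k, rfl⟩ := σ.symm.surjective i
    rw [MeasurableEquiv.coe_piCongrLeft, Equiv.piCongrLeft_apply_apply]
    simp
  simpa only [Function.comp_apply, e] using hX

/-- The `n`-particle fermionic space: the antisymmetric elements of `L²((ℝ³)ⁿ; ℂ)`.
For `n = 0` this is `L²` of a point, i.e. `ℂ`. -/
def fermionSpace (n : ℕ) : Submodule ℂ (L2 n) where
  carrier := {Ψ | ∀ σ : Equiv.Perm (Fin n),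
    (fun X : Config n => Ψ (X ∘ σ)) =ᵐ[volume]
      fun X => ((Equiv.Perm.sign σ : ℤ) : ℂ) * Ψ X}
  zero_mem' := by
    intro σ
    have h0 := Lp.coeFn_zero ℂ 2 (volume : Measure (Config n))
    filter_upwards [h0, ae_eq_comp_perm σ h0] with X hX hX'
    rw [hX, hX']
    simp
  add_mem' := by
    intro Ψ Φ hΨ hΦ σ
    have h0 := Lp.coeFn_add Ψ Φ
    filter_upwards [h0, ae_eq_comp_perm σ h0, hΨ σ, hΦ σ] with X hX hX' h2 h3
    rw [hX, hX', Pi.add_apply, Pi.add_apply, h2, h3]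
    ring
  smul_mem' := by
    intro c Ψ hΨ σ
    have h0 := Lp.coeFn_smul c Ψ
    filter_upwards [h0, ae_eq_comp_perm σ h0, hΨ σ] with X hX hX' h2
    rw [hX, hX', Pi.smul_apply, Pi.smul_apply, h2, smul_eq_mul, smul_eq_mul]
    ring

/-- The coordinate direction `a` of particle `i` in configuration space. -/
def coordDir {n : ℕ} (i : Fin n) (a : Fin 3) : Config n :=
  Pi.single i (EuclideanSpace.single a 1)

/-- `Ψ ∈ H¹`: all first-order weak partial derivatives exist and lie in `L²`. -/
def MemH1 {n : ℕ} (Ψ : L2 n) : Prop :=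
  ∀ (i : Fin n) (a : Fin 3), ∃ g : L2 n, HasWeakDeriv (Ψ : Config n → ℂ) g (coordDir i a)

open Classical in
/-- The weak partial derivative of `Ψ` in coordinate `a` of particle `i`
(with the default value `0` if there is none in `L²`). -/
def weakPartial {n : ℕ} (Ψ : L2 n) (i : Fin n) (a : Fin 3) : L2 n :=
  if h : ∃ g : L2 n, HasWeakDeriv (Ψ : Config n → ℂ) g (coordDir i a) then h.choose else 0

/-- The kinetic energy `‖∇Ψ‖²` of `Ψ ∈ H¹`. -/
def kineticForm {n : ℕ} (Ψ : L2 n) : ℝ≥0∞ :=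
  ∑ i : Fin n, ∑ a : Fin 3, ‖weakPartial Ψ i a‖ₑ ^ 2

/-- The Coulomb repulsion energy `∫ ∑_{i<k} |xᵢ - xₖ|⁻¹ |Ψ|²`. -/
def coulombForm {n : ℕ} (Ψ : L2 n) : ℝ≥0∞ :=
  ∫⁻ X : Config n,
    (∑ i : Fin n, ∑ k ∈ Finset.Ioi i, (edist (X i) (X k))⁻¹) * ‖Ψ X‖ₑ ^ 2

/-- The one-particle density `n ∫ |Ψ(x, x₂, …, xₙ)|² dx₂ ⋯ dxₙ`. -/
def waveDensity : {n : ℕ} → L2 n → Space → ℝ≥0∞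
  | 0, _, _ => 0
  | n + 1, Ψ, x => (n + 1 : ℝ≥0∞) * ∫⁻ Y : Config n, ‖Ψ (Fin.cons x Y : Config (n + 1))‖ₑ ^ 2

/-- Component `a` of the paramagnetic current density,
`n ∫ Im (∂ₐ₁Ψ · conj Ψ)(x, x₂, …, xₙ) dx₂ ⋯ dxₙ`, where `∂ₐ₁` differentiates in coordinate `a`
of the first particle. -/
def waveCurrent : {n : ℕ} → L2 n → Space → Fin 3 → ℝ
  | 0, _, _, _ => 0
  | n + 1, Ψ, x, a => (n + 1 : ℝ) * ∫ Y : Config n,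
      (weakPartial Ψ 0 a (Fin.cons x Y : Config (n + 1)) *
        star (Ψ (Fin.cons x Y : Config (n + 1)))).im

/-! ### States -/

/-- A spectral decomposition `Γ = ∑ⱼ μⱼ |Ψⱼ⟩⟨Ψⱼ|` of a nonnegative operator on the `n`-particle
space, with `μⱼ ≥ 0` and a finite or countable orthonormal family `Ψⱼ` of `H¹` functions. -/
structure SpectralDecomposition {n : ℕ} (Γ : fermionSpace n →L[ℂ] fermionSpace n) where
  /-- The index set (finite or countably infinite). -/
  J : Set ℕ
  /-- The eigenvalues. -/
  μ : J → ℝ≥0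
  /-- The eigenfunctions. -/
  Ψ : J → fermionSpace n
  orthonormal : Orthonormal ℂ Ψ
  memH1 : ∀ j, MemH1 (Ψ j : L2 n)
  hasSum : ∀ Φ : fermionSpace n,
    HasSum (fun j => ((μ j : ℝ) : ℂ) • (inner ℂ (Ψ j : L2 n) (Φ : L2 n) : ℂ) • Ψ j) (Γ Φ)

namespace SpectralDecomposition

variable {n : ℕ} {Γ : fermionSpace n →L[ℂ] fermionSpace n}

/-- `Tr Γ = ∑ⱼ μⱼ`. -/
def trace (S : SpectralDecomposition Γ) : ℝ≥0∞ := ∑' j, (S.μ j : ℝ≥0∞)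

/-- `Tr (A Γ) = ∑ⱼ μⱼ 𝒜(Ψⱼ)` for the operator `A` of a nonnegative quadratic form `𝒜`. -/
def traceForm (S : SpectralDecomposition Γ) (A : L2 n → ℝ≥0∞) : ℝ≥0∞ :=
  ∑' j, (S.μ j : ℝ≥0∞) * A (S.Ψ j)

end SpectralDecomposition

/-- An `H¹`-regular block-diagonal Fock space state `Γ₀ ⊕ Γ₁ ⊕ ⋯`: nonnegative trace class
operators `Γₙ` on the `n`-particle spaces, with `∑ₙ Tr Γₙ = 1` and `∑ₙ Tr(-Δ Γₙ) < ∞`.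
A spectral decomposition of each block is carried along; the quantities computed from it below
do not depend on its choice. -/
structure FockState where
  /-- The blocks `Γₙ`. -/
  op : ∀ n : ℕ, fermionSpace n →L[ℂ] fermionSpace n
  /-- A spectral decomposition of each block into `H¹` functions. -/
  spec : ∀ n : ℕ, SpectralDecomposition (op n)
  trace_eq_one : ∑' n, (spec n).trace = 1
  kinetic_lt_top : ∑' n, (spec n).traceForm kineticForm < ∞

namespace FockState

/-- The density `ρ_Γ`, by linearity. -/
def density (Γ : FockState) (x : Space) : ℝ≥0∞ :=
  ∑' n, (Γ.spec n).traceForm (fun Ψ => waveDensity Ψ x)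

/-- The paramagnetic current density of `Γ`, by linearity. At almost every point where the density
is finite the sums and integrals converge absolutely. -/
def current (Γ : FockState) (x : Space) : Space :=
  WithLp.toLp 2 fun a =>
    ∑' n, ∑' j, ((Γ.spec n).μ j : ℝ) * waveCurrent ((Γ.spec n).Ψ j : L2 n) x a

/-- The kinetic energy `∑ₙ Tr (-∑ⱼ Δ_{xⱼ}) Γₙ` (the term `n = 0` vanishes). -/
def kineticEnergy (Γ : FockState) : ℝ≥0∞ :=
  ∑' n, (Γ.spec n).traceForm kineticForm

/-- The energy `∑ₙ Tr (-∑ⱼ Δ_{xⱼ} + ∑_{j<k} |xⱼ - xₖ|⁻¹) Γₙ` (the term `n = 0` vanishes). -/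
def energy (Γ : FockState) : ℝ≥0∞ :=
  ∑' n, (Γ.spec n).traceForm (fun Ψ => kineticForm Ψ + coulombForm Ψ)

/-- `ρ_Γ = ρ` as elements of `L¹(ℝ³; ℝ₊)`. -/
def HasDensity (Γ : FockState) (ρ : Space → ℝ) : Prop :=
  ∀ᵐ x : Space, Γ.density x = ENNReal.ofReal (ρ x)

/-- The paramagnetic current density of `Γ` is `j`, almost everywhere. -/
def HasCurrent (Γ : FockState) (j : Space → Space) : Prop :=
  ∀ᵐ x : Space, Γ.current x = j x

end FockState

/-! ### Density functionals. The infimum of the empty set is `+∞`. -/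

/-- The kinetic energy functional `T(ρ, j)`. -/
def TCurrent (ρ : Space → ℝ) (j : Space → Space) : ℝ≥0∞ :=
  ⨅ (Γ : FockState) (_ : Γ.HasDensity ρ) (_ : Γ.HasCurrent j), Γ.kineticEnergy

/-- The grand-canonical Vignale–Rasolt functional `F(ρ, j)`. -/
def FCurrent (ρ : Space → ℝ) (j : Space → Space) : ℝ≥0∞ :=
  ⨅ (Γ : FockState) (_ : Γ.HasDensity ρ) (_ : Γ.HasCurrent j), Γ.energy

/-- The kinetic energy functional `T(ρ)`, without constraint on the current. -/
def TDensity (ρ : Space → ℝ) : ℝ≥0∞ :=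
  ⨅ (Γ : FockState) (_ : Γ.HasDensity ρ), Γ.kineticEnergy

/-- The grand-canonical Levy–Lieb functional `F(ρ)`, without constraint on the current. -/
def FDensity (ρ : Space → ℝ) : ℝ≥0∞ :=
  ⨅ (Γ : FockState) (_ : Γ.HasDensity ρ), Γ.energy

/-- The direct energy `D(ρ) = ½ ∬ ρ(x) ρ(y) / |x - y| dx dy` (finite for `ρ ∈ 𝓘`). -/
def directEnergy (ρ : Space → ℝ) : ℝ≥0∞ :=
  2⁻¹ * ∫⁻ x : Space, ∫⁻ y : Space,
    ENNReal.ofReal (ρ x) * ENNReal.ofReal (ρ y) * (edist x y)⁻¹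

/-- The indirect energy `E(ρ, j) = F(ρ, j) - D(ρ)`. -/
def ECurrent (ρ : Space → ℝ) (j : Space → Space) : EReal :=
  (FCurrent ρ j : EReal) - (directEnergy ρ : EReal)

/-- The indirect energy `E(ρ) = F(ρ) - D(ρ)`. -/
def EDensity (ρ : Space → ℝ) : EReal :=
  (FDensity ρ : EReal) - (directEnergy ρ : EReal)

/-- The exchange-correlation functional `Exc(ρ, j) = E(ρ, j) - T(ρ, j)`. -/
def ExcCurrent (ρ : Space → ℝ) (j : Space → Space) : EReal :=
  ECurrent ρ j - (TCurrent ρ j : EReal)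

/-- The exchange-correlation functional `Exc(ρ) = E(ρ) - T(ρ)`. -/
def ExcDensity (ρ : Space → ℝ) : EReal :=
  EDensity ρ - (TDensity ρ : EReal)

end CurrentDFT

end

open MeasureTheory
open scoped ENNReal NNReal

noncomputable section

/-! Averaging a state with its complex conjugate gives `Re Γ = (Γ + conj Γ)/2`, which has the same
diagonal `Γ(X, X)` and the same kinetic energy as `Γ`, but a real kernel. Real eigenfunctions carry
no paramagnetic current, while trace, density and Coulomb energy depend only on the diagonal. The
constraint of zero current is therefore free.

The work lies in producing orthonormal `H¹` eigenfunctions of `Re Γ`. The functions `√μⱼ Re Ψⱼ` and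
`√μⱼ Im Ψⱼ` form a square-summable family `v`, in general not orthogonal. Let `V` be the
Hilbert–Schmidt operator from `ℓ²` sending the unit vectors to `v`, so that `V V*` has the kernel of
`Re Γ`. An eigenbasis `b` of `V* V` has orthogonal images `V bᵢ`. Hilbert–Schmidt norms do not
depend on the basis (`tsum_enorm_sq_hilbertBasis_eq`). Applied to `V` followed by restriction to a
measurable set, this preserves the diagonal; applied to the operators built from the derivatives, it
controls the kinetic energy. `exists_orthogonal_family` carries this out, `exists_real_block`
normalizes the result, and `FockState.exists_current_eq_zero` assembles the blocks. -/

namespace CurrentDFT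

/-! ### Hilbert–Schmidt operators and singular values -/

section HilbertSchmidt

set_option linter.unusedSectionVars false

universe u

variable {H : Type u} {E : Type*} [NormedAddCommGroup H] [InnerProductSpace ℝ H] [CompleteSpace H]
  [NormedAddCommGroup E] [InnerProductSpace ℝ E] [CompleteSpace E]

/-- Parseval's identity in `ℝ≥0∞`. -/
theorem tsum_enorm_inner_sq {ι : Type*} (b : HilbertBasis ι ℝ H) (x : H) :
    ∑' i, ‖inner ℝ (b i) x‖ₑ ^ 2 = ‖x‖ₑ ^ 2 := by
  have h := b.hasSum_inner_mul_inner x x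
  rw [real_inner_self_eq_norm_sq] at h
  have e : ∀ i, inner ℝ x (b i) * inner ℝ (b i) x = ‖inner ℝ (b i) x‖ ^ 2 := fun i => by
    rw [real_inner_comm, ← sq, Real.norm_eq_abs, sq_abs]
  simp_rw [e] at h
  have h2 := ENNReal.ofReal_tsum_of_nonneg (fun i => sq_nonneg ‖inner ℝ (b i) x‖) h.summable
  rw [h.tsum_eq, ENNReal.ofReal_pow (norm_nonneg _), ofReal_norm] at h2
  rw [h2]
  refine tsum_congr fun i => ?_
  rw [ENNReal.ofReal_pow (norm_nonneg _), ofReal_norm]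

/-- By Parseval in `f` and in `b`, both sides are the double sum of `⟨f m, B (b i)⟩²`. In `ℝ≥0∞` the
order of summation may be exchanged without any summability assumption. -/
theorem tsum_enorm_sq_eq_tsum_adjoint {ι κ : Type*} (b : HilbertBasis ι ℝ H)
    (f : HilbertBasis κ ℝ E) (B : H →L[ℝ] E) :
    ∑' i, ‖B (b i)‖ₑ ^ 2 = ∑' m, ‖ContinuousLinearMap.adjoint B (f m)‖ₑ ^ 2 := by
  simp_rw [← tsum_enorm_inner_sq f (B _),
    ← tsum_enorm_inner_sq b (ContinuousLinearMap.adjoint B _)]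
  rw [ENNReal.tsum_comm]
  refine tsum_congr fun m => tsum_congr fun i => ?_
  rw [ContinuousLinearMap.adjoint_inner_right, real_inner_comm]

/-- The Hilbert–Schmidt norm does not depend on the Hilbert basis. -/
theorem tsum_enorm_sq_hilbertBasis_eq {ι κ : Type*} (b : HilbertBasis ι ℝ H)
    (c : HilbertBasis κ ℝ H) (B : H →L[ℝ] E) :
    ∑' i, ‖B (b i)‖ₑ ^ 2 = ∑' k, ‖B (c k)‖ₑ ^ 2 := by
  obtain ⟨w, f, -⟩ := exists_hilbertBasis ℝ E
  rw [tsum_enorm_sq_eq_tsum_adjoint b f, tsum_enorm_sq_eq_tsum_adjoint c f]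

/-- Cauchy–Schwarz and Bessel. The bound is uniform in `s`, so it yields both absolute convergence
and the operator norm estimate. -/
theorem sum_norm_inner_smul_le {κ : Type*} (c : HilbertBasis κ ℝ H) {v : κ → E}
    (hv : Summable fun k => ‖v k‖ ^ 2) (x : H) (s : Finset κ) :
    ∑ k ∈ s, ‖inner ℝ (c k) x • v k‖ ≤ √(∑' k, ‖v k‖ ^ 2) * ‖x‖ := by
  simp_rw [norm_smul]
  refine (Real.sum_mul_le_sqrt_mul_sqrt _ _ _).trans ?_
  rw [mul_comm]
  refine mul_le_mul (Real.sqrt_le_sqrt (hv.sum_le_tsum s fun _ _ => sq_nonneg _)) ?_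
    (Real.sqrt_nonneg _) (Real.sqrt_nonneg _)
  rw [Real.sqrt_le_left (norm_nonneg _)]
  exact c.orthonormal.sum_inner_products_le x

theorem summable_norm_inner_smul {κ : Type*} (c : HilbertBasis κ ℝ H) {v : κ → E}
    (hv : Summable fun k => ‖v k‖ ^ 2) (x : H) : Summable fun k => ‖inner ℝ (c k) x • v k‖ :=
  summable_of_sum_le (fun _ => norm_nonneg _) (sum_norm_inner_smul_le c hv x)

/-- The Hilbert–Schmidt operator which maps the vectors of a Hilbert basis to a given
square-summable family. -/
def hilbertSchmidtOp {κ : Type*} (c : HilbertBasis κ ℝ H) (v : κ → E)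
    (hv : Summable fun k => ‖v k‖ ^ 2) : H →L[ℝ] E :=
  LinearMap.mkContinuous
    { toFun := fun x => ∑' k, inner ℝ (c k) x • v k
      map_add' := fun x y => by
        simp_rw [inner_add_right, add_smul]
        exact (summable_norm_inner_smul c hv x).of_norm.tsum_add
          (summable_norm_inner_smul c hv y).of_norm
      map_smul' := fun r x => by
        simp_rw [inner_smul_right, mul_smul]
        exact (summable_norm_inner_smul c hv x).of_norm.tsum_const_smul r }
    (√(∑' k, ‖v k‖ ^ 2)) (fun x =>
      (norm_tsum_le_tsum_norm (summable_norm_inner_smul c hv x)).trans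
        ((summable_norm_inner_smul c hv x).tsum_le_of_sum_le (sum_norm_inner_smul_le c hv x)))

theorem hilbertSchmidtOp_apply {κ : Type*} (c : HilbertBasis κ ℝ H) (v : κ → E)
    (hv : Summable fun k => ‖v k‖ ^ 2) (x : H) :
    hilbertSchmidtOp c v hv x = ∑' k, inner ℝ (c k) x • v k := rfl

theorem norm_hilbertSchmidtOp_le {κ : Type*} (c : HilbertBasis κ ℝ H) (v : κ → E)
    (hv : Summable fun k => ‖v k‖ ^ 2) : ‖hilbertSchmidtOp c v hv‖ ≤ √(∑' k, ‖v k‖ ^ 2) :=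
  LinearMap.mkContinuous_norm_le _ (Real.sqrt_nonneg _) _

theorem hilbertSchmidtOp_basis {κ : Type*} (c : HilbertBasis κ ℝ H) (v : κ → E)
    (hv : Summable fun k => ‖v k‖ ^ 2) (k : κ) : hilbertSchmidtOp c v hv (c k) = v k := by
  classical
  rw [hilbertSchmidtOp_apply, tsum_eq_single k]
  · rw [real_inner_self_eq_norm_sq, c.orthonormal.1 k]; simp
  · intro l hl
    rw [c.orthonormal.2 hl, zero_smul]

/-- A norm limit of finite-rank truncations: the error is the operator of the tail family, whose
norm is at most the square root of the tail of a convergent series. -/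
theorem isCompactOperator_hilbertSchmidtOp {κ : Type*} (c : HilbertBasis κ ℝ H) (v : κ → E)
    (hv : Summable fun k => ‖v k‖ ^ 2) : IsCompactOperator (hilbertSchmidtOp c v hv) := by
  classical
  let F : Finset κ → H →L[ℝ] E := fun s => ∑ k ∈ s, (innerSL ℝ (c k)).smulRight (v k)
  have hF : ∀ s, IsCompactOperator (F s) := by
    intro s
    refine (compactOperator (RingHom.id ℝ) H E).sum_mem (t := s)
      (f := fun k => (innerSL ℝ (c k)).smulRight (v k)) ?_
    intro k _
    exact (isCompactOperator_of_locallyCompactSpace_rng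
      (ContinuousLinearMap.toSpanSingleton ℝ (v k))).comp_clm (innerSL ℝ (c k))
  refine isCompactOperator_of_tendsto (F := F) (l := Filter.atTop) ?_
    (Filter.Eventually.of_forall hF)
  have h0 := (tendsto_tsum_compl_atTop_zero fun k => ‖v k‖ ^ 2).sqrt
  rw [Real.sqrt_zero] at h0
  rw [tendsto_iff_norm_sub_tendsto_zero]
  refine squeeze_zero (fun _ => norm_nonneg _) (fun s => ?_) h0
  let v' : κ → E := fun k => if k ∈ s then 0 else v k
  have hv' : (fun k => ‖v' k‖ ^ 2) = Set.indicator {k | k ∉ s} (fun k => ‖v k‖ ^ 2) := by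
    funext k
    by_cases hk : k ∈ s <;> simp [v', hk]
  have hs : Summable fun k => ‖v' k‖ ^ 2 := by
    rw [hv']; exact hv.indicator _
  have he : hilbertSchmidtOp c v hv - F s = hilbertSchmidtOp c v' hs := by
    ext x
    rw [sub_apply, hilbertSchmidtOp_apply, hilbertSchmidtOp_apply,
      ← (summable_norm_inner_smul c hv x).of_norm.sum_add_tsum_subtype_compl s]
    simp only [F, sum_apply, ContinuousLinearMap.smulRight_apply,
      innerSL_apply_apply, add_sub_cancel_left]
    change ∑' k : ({k | k ∉ s} : Set κ), inner ℝ (c (k : κ)) x • v (k : κ) = _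
    rw [tsum_subtype {k | k ∉ s} (fun k => inner ℝ (c k) x • v k)]
    refine tsum_congr fun k => ?_
    by_cases hk : k ∈ s <;> simp [v', Set.indicator, hk]
  rw [norm_sub_rev, he]
  refine (norm_hilbertSchmidtOp_le c v' hs).trans (le_of_eq ?_)
  rw [hv', ← tsum_subtype]
  rfl

/-- The spectral theorem: a compact symmetric operator has a Hilbert basis of eigenvectors. -/
theorem exists_hilbertBasis_eigenvectors (T : H →L[ℝ] H) (hT : IsCompactOperator T)
    (hs : (T : H →ₗ[ℝ] H).IsSymmetric) :
    ∃ (ι : Type u) (b : HilbertBasis ι ℝ H) (l : ι → ℝ), ∀ i, T (b i) = l i • b i := by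
  have hcl : ∀ m : ℝ, IsClosed (Module.End.eigenspace (T : H →ₗ[ℝ] H) m : Set H) := by
    intro m
    have : (Module.End.eigenspace (T : H →ₗ[ℝ] H) m : Set H) = {x | T x = m • x} := by
      ext x; simp
    rw [this]
    exact isClosed_eq T.continuous (continuous_const_smul m)
  have hc : ∀ m : ℝ, CompleteSpace (Module.End.eigenspace (T : H →ₗ[ℝ] H) m) :=
    fun m => (hcl m).completeSpace_coe
  choose w f hf using fun m : ℝ =>
    have := hc m
    exists_hilbertBasis ℝ (Module.End.eigenspace (T : H →ₗ[ℝ] H) m)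
  -- Eigenspaces of distinct eigenvalues are orthogonal, so bases of the separate eigenspaces
  -- combine into one orthonormal family.
  have ho := hs.orthogonalFamily_eigenspaces.orthonormal_sigma_orthonormal
    (fun m => (f m).orthonormal)
  refine ⟨_, HilbertBasis.mkOfOrthogonalEqBot ho ?_, Sigma.fst, ?_⟩
  · rw [eq_bot_iff, ← ContinuousLinearMap.orthogonalComplement_iSup_eigenspaces_eq_bot hT hs]
    intro y hy
    rw [← Submodule.iInf_orthogonal, Submodule.mem_iInf]
    intro m x hx
    have := hc m
    -- Expanding `z` in the chosen basis of its eigenspace shows that `y` is orthogonal to the whole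
    -- eigenspace.
    have hy' : ∀ z : Module.End.eigenspace (T : H →ₗ[ℝ] H) m, inner ℝ y (z : H) = 0 := by
      intro z
      have hd := (f m).hasSum_repr z
      have hd2 := ((innerSL ℝ y).comp (Submodule.subtypeL _)).hasSum hd
      refine hd2.unique ?_
      convert hasSum_zero using 2 with i
      rw [map_smul]
      have : inner ℝ y ((f m i : Module.End.eigenspace (T : H →ₗ[ℝ] H) m) : H) = 0 := by
        rw [real_inner_comm]
        exact (Submodule.mem_orthogonal _ _).1 hy _ (Submodule.subset_span ⟨⟨m, i⟩, rfl⟩)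
      simp [this]
    rw [real_inner_comm]
    exact hy' ⟨x, hx⟩
  · rintro ⟨m, i⟩
    rw [HilbertBasis.coe_mkOfOrthogonalEqBot]
    exact Module.End.mem_eigenspace_iff.1 (f m i).2

/-- A singular value decomposition: some Hilbert basis is mapped to an orthogonal family. -/
theorem exists_hilbertBasis_orthogonal_image (V : H →L[ℝ] E) (hV : IsCompactOperator V) :
    ∃ (ι : Type u) (b : HilbertBasis ι ℝ H), ∀ i j, i ≠ j → inner ℝ (V (b i)) (V (b j)) = 0 := by
  obtain ⟨ι, b, l, h⟩ := exists_hilbertBasis_eigenvectors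
    ((ContinuousLinearMap.adjoint V).comp V) (hV.clm_comp (ContinuousLinearMap.adjoint V)) (by
      intro x y
      simp [ContinuousLinearMap.adjoint_inner_left, ContinuousLinearMap.adjoint_inner_right])
  refine ⟨ι, b, fun i j hij => ?_⟩
  rw [← ContinuousLinearMap.adjoint_inner_right, ← ContinuousLinearMap.comp_apply, h,
    inner_smul_right, b.orthonormal.2 hij, mul_zero]

end HilbertSchmidt

/-! ### Weak derivatives in `L²` -/

section WeakDerivative

set_option linter.unusedSectionVars false

variable {E F G : Type*} [NormedAddCommGroup E] [NormedSpace ℝ E] [MeasureSpace E]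
  [NormedAddCommGroup F] [NormedSpace ℝ F] [NormedAddCommGroup G] [NormedSpace ℝ G]

theorem HasWeakDeriv.congr_ae {u u' g g' : E → F} {v : E} (h : HasWeakDeriv u g v)
    (hu : u =ᵐ[volume] u') (hg : g =ᵐ[volume] g') : HasWeakDeriv u' g' v := by
  intro φ hφ hc
  have h1 : ∫ x, (fderiv ℝ φ x v) • u' x = ∫ x, (fderiv ℝ φ x v) • u x :=
    integral_congr_ae (by filter_upwards [hu] with x hx; rw [hx])
  have h2 : ∫ x, φ x • g' x = ∫ x, φ x • g x :=
    integral_congr_ae (by filter_upwards [hg] with x hx; rw [hx])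
  rw [h1, h2, h φ hφ hc]

theorem continuous_fderiv_apply_of_contDiff {φ : E → ℝ} (hφ : ContDiff ℝ (⊤ : ℕ∞) φ) (v : E) :
    Continuous fun x => fderiv ℝ φ x v :=
  (hφ.continuous_fderiv (by simp)).clm_apply continuous_const

variable [BorelSpace E] [FiniteDimensional ℝ E] [IsFiniteMeasureOnCompacts (volume : Measure E)]

theorem integrable_smul_of_hasCompactSupport {φ : E → ℝ} (hφ : Continuous φ)
    (hc : HasCompactSupport φ) (u : Lp F 2 (volume : Measure E)) :
    Integrable fun x => φ x • u x :=
  have : ProperSpace E := FiniteDimensional.proper_real E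
  ((Lp.memLp u).locallyIntegrable (by norm_num)).integrable_smul_left_of_hasCompactSupport hφ hc

theorem HasWeakDeriv.clm_comp [CompleteSpace F] [CompleteSpace G]
    {u g : Lp F 2 (volume : Measure E)} {v : E} (h : HasWeakDeriv u g v)
    (L : F →L[ℝ] G) : HasWeakDeriv (fun x => L (u x)) (fun x => L (g x)) v := by
  intro φ hφ hc
  have h0 := congrArg L (h φ hφ hc)
  rw [map_neg, ← L.integral_comp_comm (integrable_smul_of_hasCompactSupport hφ.continuous hc g),
    ← L.integral_comp_comm (integrable_smul_of_hasCompactSupport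
      (continuous_fderiv_apply_of_contDiff hφ v) (hc.fderiv_apply ℝ v) u)] at h0
  simpa using h0

theorem HasWeakDeriv.unique [CompleteSpace F] {u : E → F} {g g' : Lp F 2 (volume : Measure E)}
    {v : E} (h : HasWeakDeriv u g v) (h' : HasWeakDeriv u g' v) : g = g' := by
  have : ProperSpace E := FiniteDimensional.proper_real E
  refine Lp.ext (ae_eq_of_integral_contDiff_smul_eq
    ((Lp.memLp g).locallyIntegrable (by norm_num)) ((Lp.memLp g').locallyIntegrable (by norm_num))
    fun φ hφ hc => ?_)
  exact neg_injective ((h φ hφ hc).symm.trans (h' φ hφ hc))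

theorem integral_mul_eq_inner_toLp {φ : E → ℝ} (hφ : MemLp φ 2 (volume : Measure E))
    (u : Lp ℝ 2 (volume : Measure E)) : ∫ x, φ x • u x = inner ℝ (hφ.toLp φ) u := by
  rw [L2.inner_def]
  refine integral_congr_ae ?_
  filter_upwards [hφ.coeFn_toLp] with x hx
  rw [hx]
  simp [mul_comm]

/-- For a fixed test function, both sides of the defining identity are continuous linear functionals
of `x`, so agreement on the basis suffices. -/
theorem hasWeakDeriv_of_hilbertBasis {H κ : Type*} [NormedAddCommGroup H] [InnerProductSpace ℝ H]
    (c : HilbertBasis κ ℝ H) (V W : H →L[ℝ] Lp ℝ 2 (volume : Measure E)) {v : E}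
    (h : ∀ k, HasWeakDeriv (V (c k) : E → ℝ) (W (c k)) v) (x : H) :
    HasWeakDeriv (V x : E → ℝ) (W x) v := by
  intro φ hφ hc
  have m1 : MemLp φ 2 (volume : Measure E) := hφ.continuous.memLp_of_hasCompactSupport hc
  have m2 : MemLp (fun x => fderiv ℝ φ x v) 2 (volume : Measure E) :=
    (continuous_fderiv_apply_of_contDiff hφ v).memLp_of_hasCompactSupport (hc.fderiv_apply ℝ v)
  have e : (innerSL ℝ (m2.toLp _)).comp V = -(innerSL ℝ (m1.toLp φ)).comp W := by
    refine ContinuousLinearMap.ext_on (s := Set.range c) ?_ ?_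
    · rw [Submodule.dense_iff_topologicalClosure_eq_top]
      exact c.dense_span
    · rintro _ ⟨k, rfl⟩
      have := h k φ hφ hc
      rw [integral_mul_eq_inner_toLp m1, integral_mul_eq_inner_toLp m2] at this
      simpa using this
  rw [integral_mul_eq_inner_toLp m1, integral_mul_eq_inner_toLp m2]
  simpa using congrArg (fun L => L x) e

end WeakDerivative

theorem enorm_sq_eq_lintegral {α F : Type*} [MeasurableSpace α] {m : Measure α}
    [NormedAddCommGroup F] (f : Lp F 2 m) : ‖f‖ₑ ^ 2 = ∫⁻ x, ‖f x‖ₑ ^ 2 ∂m := by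
  have := eLpNorm_nnreal_pow_eq_lintegral (f := (f : α → F)) (μ := m) (p := 2) (by norm_num)
  rw [Lp.enorm_def]
  simpa using this

/-! ### Real and imaginary parts of wave functions -/

section RealWaves

variable {n : ℕ}

/-- Real-valued square-integrable functions on configuration space. -/
abbrev RealL2 (n : ℕ) : Type := Lp ℝ 2 (volume : Measure (Config n))

/-- The inclusion of the real into the complex functions. -/
def complexify : RealL2 n →L[ℝ] L2 n := Complex.ofRealCLM.compLpL 2 volume

/-- The real part. -/
def rePart : L2 n →L[ℝ] RealL2 n := Complex.reCLM.compLpL 2 volume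

/-- The imaginary part. -/
def imPart : L2 n →L[ℝ] RealL2 n := Complex.imCLM.compLpL 2 volume

theorem coeFn_complexify (f : RealL2 n) : complexify f =ᵐ[volume] fun X => (f X : ℂ) :=
  Complex.ofRealCLM.coeFn_compLpL f

theorem coeFn_rePart (f : L2 n) : rePart f =ᵐ[volume] fun X => (f X).re :=
  Complex.reCLM.coeFn_compLpL f

theorem coeFn_imPart (f : L2 n) : imPart f =ᵐ[volume] fun X => (f X).im :=
  Complex.imCLM.coeFn_compLpL f

theorem inner_complexify (f g : RealL2 n) :
    inner ℂ (complexify f) (complexify g) = ((inner ℝ f g : ℝ) : ℂ) := by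
  rw [L2.inner_def, L2.inner_def, ← integral_complex_ofReal]
  refine integral_congr_ae ?_
  filter_upwards [coeFn_complexify f, coeFn_complexify g] with X h1 h2
  rw [h1, h2]
  simp

theorem enorm_complexify (f : RealL2 n) : ‖complexify f‖ₑ = ‖f‖ₑ := by
  rw [Lp.enorm_def, Lp.enorm_def]
  refine eLpNorm_congr_norm_ae ?_
  filter_upwards [coeFn_complexify f] with X h1
  rw [h1, Complex.norm_real]

theorem enorm_sq_re_add_im (z : ℂ) : ‖z.re‖ₑ ^ 2 + ‖z.im‖ₑ ^ 2 = ‖z‖ₑ ^ 2 := by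
  simp_rw [← ofReal_norm, ← ENNReal.ofReal_pow (norm_nonneg _)]
  rw [← ENNReal.ofReal_add (sq_nonneg _) (sq_nonneg _), Complex.sq_norm, Complex.normSq_apply]
  simp [sq]

theorem enorm_sq_rePart_add_imPart (f : L2 n) :
    ‖rePart f‖ₑ ^ 2 + ‖imPart f‖ₑ ^ 2 = ‖f‖ₑ ^ 2 := by
  simp_rw [enorm_sq_eq_lintegral]
  rw [← lintegral_add_left (by fun_prop)]
  refine lintegral_congr_ae ?_
  filter_upwards [coeFn_rePart f, coeFn_imPart f] with X h1 h2
  rw [h1, h2, enorm_sq_re_add_im]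

/-- Uniqueness of weak derivatives makes the choice in `weakPartial` immaterial. -/
theorem weakPartial_eq {Ψ g : L2 n} {i : Fin n} {a : Fin 3}
    (h : HasWeakDeriv (Ψ : Config n → ℂ) g (coordDir i a)) : weakPartial Ψ i a = g := by
  have h0 : ∃ g : L2 n, HasWeakDeriv (Ψ : Config n → ℂ) g (coordDir i a) := ⟨g, h⟩
  rw [weakPartial, dif_pos h0]
  exact h0.choose_spec.unique h

theorem MemH1.hasWeakDeriv {Ψ : L2 n} (h : MemH1 Ψ) (i : Fin n) (a : Fin 3) :
    HasWeakDeriv (Ψ : Config n → ℂ) (weakPartial Ψ i a) (coordDir i a) := by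
  rw [weakPartial, dif_pos (h i a)]
  exact (h i a).choose_spec

theorem hasWeakDeriv_complexify {f g : RealL2 n} {v : Config n}
    (h : HasWeakDeriv (f : Config n → ℝ) g v) :
    HasWeakDeriv (complexify f : Config n → ℂ) (complexify g) v :=
  (h.clm_comp Complex.ofRealCLM).congr_ae (coeFn_complexify f).symm (coeFn_complexify g).symm

theorem hasWeakDeriv_rePart {f g : L2 n} {v : Config n}
    (h : HasWeakDeriv (f : Config n → ℂ) g v) :
    HasWeakDeriv (rePart f : Config n → ℝ) (rePart g) v :=
  (h.clm_comp Complex.reCLM).congr_ae (coeFn_rePart f).symm (coeFn_rePart g).symm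

theorem hasWeakDeriv_imPart {f g : L2 n} {v : Config n}
    (h : HasWeakDeriv (f : Config n → ℂ) g v) :
    HasWeakDeriv (imPart f : Config n → ℝ) (imPart g) v :=
  (h.clm_comp Complex.imCLM).congr_ae (coeFn_imPart f).symm (coeFn_imPart g).symm

theorem HasWeakDeriv.const_smul_realL2 {f g : RealL2 n} {v : Config n}
    (h : HasWeakDeriv (f : Config n → ℝ) g v) (r : ℝ) :
    HasWeakDeriv (r • f : RealL2 n) (r • g : RealL2 n) v :=
  (h.clm_comp (r • ContinuousLinearMap.id ℝ ℝ)).congr_ae (Lp.coeFn_smul r f).symm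
    (Lp.coeFn_smul r g).symm

/-- For each permutation, antisymmetry equates two continuous maps of `Ψ`: an isometric composition
and multiplication by a sign. -/
theorem isClosed_fermionSpace (n : ℕ) : IsClosed (fermionSpace n : Set (L2 n)) := by
  have mp : ∀ σ : Equiv.Perm (Fin n),
      MeasurePreserving (fun X : Config n => X ∘ σ) volume volume := by
    intro σ
    have h := volume_measurePreserving_piCongrLeft (fun _ : Fin n => Space) σ.symm
    convert h using 1
    funext X i
    obtain ⟨k, rfl⟩ := σ.symm.surjective i
    rw [MeasurableEquiv.coe_piCongrLeft, Equiv.piCongrLeft_apply_apply]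
    simp
  have e : (fermionSpace n : Set (L2 n)) = ⋂ σ : Equiv.Perm (Fin n),
      {Ψ | Lp.compMeasurePreserving (fun X : Config n => X ∘ σ) (mp σ) Ψ =
        ((Equiv.Perm.sign σ : ℤ) : ℂ) • Ψ} := by
    ext Ψ
    rw [Set.mem_iInter]
    refine forall_congr' fun σ => ?_
    have h1 := Lp.coeFn_compMeasurePreserving Ψ (mp σ)
    have h2 := Lp.coeFn_smul ((Equiv.Perm.sign σ : ℤ) : ℂ) Ψ
    constructor
    · intro h
      exact Lp.ext (h1.trans (Filter.EventuallyEq.trans h h2.symm))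
    · intro h
      refine h1.symm.trans (Filter.EventuallyEq.trans ?_ h2)
      rw [show _ = _ from h]
  rw [e]
  exact isClosed_iInter fun σ => isClosed_eq
    (Lp.isometry_compMeasurePreserving (mp σ)).continuous (continuous_const_smul _)

instance (n : ℕ) : CompleteSpace (fermionSpace n) := (isClosed_fermionSpace n).completeSpace_coe

theorem complexify_rePart_mem {Ψ : L2 n} (h : Ψ ∈ fermionSpace n) :
    complexify (rePart Ψ) ∈ fermionSpace n := by
  intro σ
  have h1 := (coeFn_complexify (rePart Ψ)).trans
    ((coeFn_rePart Ψ).fun_comp (fun r : ℝ => (r : ℂ)))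
  filter_upwards [h1, ae_eq_comp_perm σ h1, h σ] with X hX hX' hσ
  rw [hX, hX']
  simp [Function.comp_apply, hσ]

theorem complexify_imPart_mem {Ψ : L2 n} (h : Ψ ∈ fermionSpace n) :
    complexify (imPart Ψ) ∈ fermionSpace n := by
  intro σ
  have h1 := (coeFn_complexify (imPart Ψ)).trans
    ((coeFn_imPart Ψ).fun_comp (fun r : ℝ => (r : ℂ)))
  filter_upwards [h1, ae_eq_comp_perm σ h1, h σ] with X hX hX' hσ
  rw [hX, hX']
  simp [Function.comp_apply, hσ]

end RealWaves

/-! ### The weighted real family of a block -/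

section RealFamily

variable {n : ℕ} {J : Type*}

theorem enorm_sqrt_smul_sq {F : Type*} [NormedAddCommGroup F] [NormedSpace ℝ F] (m : ℝ≥0) (f : F) :
    ‖√(m : ℝ) • f‖ₑ ^ 2 = m * ‖f‖ₑ ^ 2 := by
  rw [enorm_smul, mul_pow]
  congr 1
  rw [← ofReal_norm, ← ENNReal.ofReal_pow (norm_nonneg _), Real.norm_eq_abs, sq_abs,
    Real.sq_sqrt m.coe_nonneg, ENNReal.ofReal_coe_nnreal]

/-- The real and imaginary parts of a family of wave functions, weighted by `√μⱼ`. -/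
def realFamily (μ : J → ℝ≥0) (Θ : J → L2 n) (k : J × Bool) : RealL2 n :=
  √(μ k.1 : ℝ) • bif k.2 then rePart (Θ k.1) else imPart (Θ k.1)

theorem tsum_enorm_sq_realFamily (μ : J → ℝ≥0) (Θ : J → L2 n) :
    ∑' k, ‖realFamily μ Θ k‖ₑ ^ 2 = ∑' j, (μ j : ℝ≥0∞) * ‖Θ j‖ₑ ^ 2 := by
  rw [ENNReal.tsum_prod']
  refine tsum_congr fun j => ?_
  simp only [tsum_bool, realFamily, enorm_sqrt_smul_sq, cond_true, cond_false]
  rw [← mul_add, add_comm, enorm_sq_rePart_add_imPart]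

theorem tsum_enorm_sq_realFamily_apply [Countable J] (μ : J → ℝ≥0) (Θ : J → L2 n) :
    ∀ᵐ X : Config n, ∑' k, ‖realFamily μ Θ k X‖ₑ ^ 2 = ∑' j, (μ j : ℝ≥0∞) * ‖Θ j X‖ₑ ^ 2 := by
  have h1 : ∀ᵐ X : Config n, ∀ j, realFamily μ Θ (j, true) X = √(μ j : ℝ) * (Θ j X).re := by
    refine ae_all_iff.2 fun j => ?_
    filter_upwards [Lp.coeFn_smul √(μ j : ℝ) (rePart (Θ j)), coeFn_rePart (Θ j)] with X h1 h2
    simp only [realFamily, cond_true]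
    rw [h1, Pi.smul_apply, h2, smul_eq_mul]
  have h2 : ∀ᵐ X : Config n, ∀ j, realFamily μ Θ (j, false) X = √(μ j : ℝ) * (Θ j X).im := by
    refine ae_all_iff.2 fun j => ?_
    filter_upwards [Lp.coeFn_smul √(μ j : ℝ) (imPart (Θ j)), coeFn_imPart (Θ j)] with X h1 h2
    simp only [realFamily, cond_false]
    rw [h1, Pi.smul_apply, h2, smul_eq_mul]
  filter_upwards [h1, h2] with X h1 h2
  rw [ENNReal.tsum_prod']
  refine tsum_congr fun j => ?_
  rw [tsum_bool, h1, h2, ← smul_eq_mul, ← smul_eq_mul, enorm_sqrt_smul_sq, enorm_sqrt_smul_sq,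
    ← mul_add, add_comm, enorm_sq_re_add_im]

theorem summable_norm_sq_of_tsum_enorm_sq_ne_top {α F : Type*} [NormedAddCommGroup F] {v : α → F}
    (h : ∑' k, ‖v k‖ₑ ^ 2 ≠ ∞) : Summable fun k => ‖v k‖ ^ 2 := by
  have := ENNReal.summable_toReal h
  simpa using this

end RealFamily

/-! ### Orthogonalization at fixed diagonal -/

section Orthogonalization

variable {n : ℕ}

/-- The rank-one projections have norm `1`, so the series converges absolutely in operator norm. -/
theorem exists_hasSum_smul_inner_smul {H J : Type*} [NormedAddCommGroup H]
    [InnerProductSpace ℂ H] [CompleteSpace H] {Ψ : J → H} (hΨ : ∀ j, ‖Ψ j‖ = 1) {μ : J → ℝ≥0}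
    (hμ : Summable fun j => (μ j : ℝ)) :
    ∃ T : H →L[ℂ] H, ∀ x, HasSum (fun j => ((μ j : ℝ) : ℂ) • inner ℂ (Ψ j) x • Ψ j) (T x) := by
  have hT : Summable fun j => ((μ j : ℝ) : ℂ) • (innerSL ℂ (Ψ j)).smulRight (Ψ j) := by
    refine Summable.of_norm_bounded hμ fun j => ?_
    rw [norm_smul, ContinuousLinearMap.norm_smulRight_apply, innerSL_apply_norm, hΨ j]
    simp
  refine ⟨∑' j, ((μ j : ℝ) : ℂ) • (innerSL ℂ (Ψ j)).smulRight (Ψ j), fun x => ?_⟩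
  have h := (ContinuousLinearMap.apply ℂ H x).hasSum hT.hasSum
  simpa only [ContinuousLinearMap.apply_apply, smul_apply,
    ContinuousLinearMap.smulRight_apply, innerSL_apply_apply] using h

/-- Normalizing `Φ i` moves its squared norm into the eigenvalue; real orthogonality persists over
`ℂ` because complexification preserves inner products. -/
theorem exists_spectralDecomposition_of_orthogonal {I : Type*} [Countable I] (Φ : I → RealL2 n)
    (D : I → Fin n → Fin 3 → RealL2 n)
    (h0 : ∀ i, Φ i ≠ 0) (ho : Pairwise fun i j => inner ℝ (Φ i) (Φ j) = 0)
    (hf : ∀ i, complexify (Φ i) ∈ fermionSpace n)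
    (hD : ∀ i p a, HasWeakDeriv (Φ i : Config n → ℝ) (D i p a) (coordDir p a))
    (hs : Summable fun i => ‖Φ i‖ ^ 2) :
    ∃ (Γ : fermionSpace n →L[ℂ] fermionSpace n) (S : SpectralDecomposition Γ) (e : S.J ≃ I),
      (∀ j, S.μ j = ‖Φ (e j)‖₊ ^ 2) ∧
      ∀ j, (S.Ψ j : L2 n) = complexify (‖Φ (e j)‖⁻¹ • Φ (e j)) := by
  obtain ⟨r, hr⟩ := exists_injective_nat I
  let e : Set.range r ≃ I := (Equiv.ofInjective r hr).symm
  have hm : ∀ i, complexify (‖Φ i‖⁻¹ • Φ i) ∈ fermionSpace n := fun i => by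
    rw [map_smul]
    exact ((fermionSpace n).restrictScalars ℝ).smul_mem _ (hf i)
  let Ψ : Set.range r → fermionSpace n := fun j => ⟨_, hm (e j)⟩
  have hon : Orthonormal ℂ Ψ := by
    constructor
    · intro j
      have : ‖complexify (‖Φ (e j)‖⁻¹ • Φ (e j))‖ₑ = ‖(1 : ℝ)‖ₑ := by
        rw [enorm_complexify, ← enorm_norm, norm_smul, norm_inv, norm_norm,
          inv_mul_cancel₀ (norm_ne_zero_iff.2 (h0 _))]
      rw [enorm_eq_iff_norm_eq, norm_one] at this
      exact this
    · intro j k hjk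
      change inner ℂ (complexify _) (complexify _) = 0
      rw [inner_complexify, inner_smul_left, inner_smul_right, ho (e.injective.ne hjk)]
      simp
  let μ : Set.range r → ℝ≥0 := fun j => ‖Φ (e j)‖₊ ^ 2
  have hμ : Summable fun j => (μ j : ℝ) := by
    have := e.summable_iff.2 hs
    simpa [μ, Function.comp_def] using this
  obtain ⟨T, hT⟩ := exists_hasSum_smul_inner_smul hon.1 hμ
  refine ⟨T, ⟨Set.range r, μ, Ψ, hon, ?_, hT⟩, e, fun j => rfl, fun j => rfl⟩
  intro j p a
  exact ⟨_, hasWeakDeriv_complexify ((hD (e j) p a).const_smul_realL2 _)⟩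

/-- Local integrals become squared norms of a continuous linear image of `f`, to which basis
independence of the Hilbert–Schmidt norm applies. -/
theorem enorm_sq_restrict (f : RealL2 n) (s : Set (Config n)) :
    ‖LpToLpRestrictCLM (Config n) ℝ ℝ volume 2 s f‖ₑ ^ 2 = ∫⁻ X in s, ‖f X‖ₑ ^ 2 := by
  rw [enorm_sq_eq_lintegral]
  refine lintegral_congr_ae ?_
  filter_upwards [LpToLpRestrictCLM_coeFn ℝ s f] with X h
  rw [h]

/-- A square-summable family of real functions with square-summable derivatives can be replaced by
an orthogonal family without changing the density. -/
theorem exists_orthogonal_family {κ : Type} [Countable κ] (v : κ → RealL2 n)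
    (dv : Fin n → Fin 3 → κ → RealL2 n)
    (hd : ∀ k p a, HasWeakDeriv (v k : Config n → ℝ) (dv p a k) (coordDir p a))
    (hf : ∀ k, complexify (v k) ∈ fermionSpace n)
    (hv : Summable fun k => ‖v k‖ ^ 2) (hdv : ∀ p a, Summable fun k => ‖dv p a k‖ ^ 2) :
    ∃ (I : Type) (_ : Countable I) (Φ : I → RealL2 n) (D : I → Fin n → Fin 3 → RealL2 n),
      (∀ i, Φ i ≠ 0) ∧ (Pairwise fun i j => inner ℝ (Φ i) (Φ j) = 0) ∧
      (∀ i, complexify (Φ i) ∈ fermionSpace n) ∧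
      (∀ i p a, HasWeakDeriv (Φ i : Config n → ℝ) (D i p a) (coordDir p a)) ∧
      (Summable fun i => ‖Φ i‖ ^ 2) ∧
      (∀ p a, ∑' i, ‖D i p a‖ₑ ^ 2 ≤ ∑' k, ‖dv p a k‖ₑ ^ 2) ∧
      ∀ᵐ X : Config n, ∑' i, ‖Φ i X‖ₑ ^ 2 = ∑' k, ‖v k X‖ₑ ^ 2 := by
  let c : HilbertBasis κ ℝ (lp (fun _ : κ => ℝ) 2) := ⟨LinearIsometryEquiv.refl ℝ _⟩
  let V := hilbertSchmidtOp c v hv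
  let W := fun p a => hilbertSchmidtOp c (dv p a) (hdv p a)
  have hVc : ∀ k, V (c k) = v k := hilbertSchmidtOp_basis c v hv
  have hWc : ∀ p a k, W p a (c k) = dv p a k := fun p a =>
    hilbertSchmidtOp_basis c (dv p a) (hdv p a)
  obtain ⟨ι, b, hb⟩ :=
    exists_hilbertBasis_orthogonal_image V (isCompactOperator_hilbertSchmidtOp c v hv)
  have hsum : ∑' i, ‖V (b i)‖ₑ ^ 2 ≠ ∞ := by
    rw [tsum_enorm_sq_hilbertBasis_eq b c V]
    simp_rw [hVc]
    have := hv.tsum_ofReal_ne_top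
    simpa [ENNReal.ofReal_pow] using this
  -- Vanishing images cannot be normalized and contribute nothing to the diagonal. Countability of
  -- the rest follows from the finite sum of squares.
  let I := {i // V (b i) ≠ 0}
  have hI : Countable I := by
    have h1 := Summable.countable_support_ennreal hsum
    have h2 : (Function.support fun i => ‖V (b i)‖ₑ ^ 2) = {i | V (b i) ≠ 0} := by
      ext i; simp
    rw [h2] at h1
    exact h1.to_subtype
  have hsub : ∀ g : ι → ℝ≥0∞, (∀ i, V (b i) = 0 → g i = 0) → ∑' i : I, g i = ∑' i, g i := by
    intro g hg
    refine tsum_subtype_eq_of_support_subset (s := {i | V (b i) ≠ 0}) fun i hi h => hi (hg i h)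
  refine ⟨I, hI, fun i => V (b i), fun i p a => W p a (b i), fun i => i.2,
    fun i j hij => hb _ _ (Subtype.coe_injective.ne hij), fun i => ?_, fun i p a => ?_, ?_,
    fun p a => ?_, ?_⟩
  · have hcl : IsClosed ((fermionSpace n).restrictScalars ℝ : Set (L2 n)) := isClosed_fermionSpace n
    have hcl2 : IsClosed (((fermionSpace n).restrictScalars ℝ).comap
        (complexify.comp V : lp (fun _ : κ => ℝ) 2 →ₗ[ℝ] L2 n) : Set (lp (fun _ : κ => ℝ) 2)) :=
      hcl.preimage (complexify.comp V).continuous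
    have h1 : Submodule.span ℝ (Set.range c) ≤ ((fermionSpace n).restrictScalars ℝ).comap
        (complexify.comp V : lp (fun _ : κ => ℝ) 2 →ₗ[ℝ] L2 n) := by
      rw [Submodule.span_le]
      rintro _ ⟨k, rfl⟩
      have : complexify (V (c k)) ∈ fermionSpace n := by rw [hVc]; exact hf k
      exact this
    have h2 := Submodule.topologicalClosure_minimal _ h1 hcl2
    rw [c.dense_span] at h2
    exact h2 (Submodule.mem_top (x := b i))
  · refine hasWeakDeriv_of_hilbertBasis c V (W p a) (fun k => ?_) _
    rw [hVc, hWc]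
    exact hd k p a
  · exact (summable_norm_sq_of_tsum_enorm_sq_ne_top hsum).subtype _
  · refine (ENNReal.tsum_comp_le_tsum_of_injective Subtype.coe_injective
      fun i => ‖W p a (b i)‖ₑ ^ 2).trans (le_of_eq ?_)
    rw [tsum_enorm_sq_hilbertBasis_eq b c (W p a)]
    simp_rw [hWc]
  · refine ae_eq_of_forall_setLIntegral_eq_of_sigmaFinite (by fun_prop) (by fun_prop) ?_
    intro s hs _
    rw [lintegral_tsum (fun _ => by fun_prop), lintegral_tsum (fun _ => by fun_prop)]
    simp_rw [← enorm_sq_restrict]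
    have h := tsum_enorm_sq_hilbertBasis_eq b c
      ((LpToLpRestrictCLM (Config n) ℝ ℝ volume 2 s).comp V)
    simp only [ContinuousLinearMap.comp_apply, hVc] at h
    rw [← h]
    exact hsub (fun i => ‖LpToLpRestrictCLM (Config n) ℝ ℝ volume 2 s (V (b i))‖ₑ ^ 2)
      fun i hi => by simp [hi]

end Orthogonalization

/-! ### Real replacement of a single block -/

theorem nnnorm_sq_mul_enorm_inv_smul_sq {F G : Type*} [NormedAddCommGroup F] [NormedAddCommGroup G]
    [NormedSpace ℝ G] {f : F} (hf : f ≠ 0) (g : G) :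
    ((‖f‖₊ ^ 2 : ℝ≥0) : ℝ≥0∞) * ‖‖f‖⁻¹ • g‖ₑ ^ 2 = ‖g‖ₑ ^ 2 := by
  have h0 : ‖f‖ₑ ≠ 0 := by simpa using hf
  rw [enorm_smul, mul_pow, ← mul_assoc, enorm_inv (norm_ne_zero_iff.2 hf), enorm_norm,
    ENNReal.coe_pow, ← enorm_eq_nnnorm, ← mul_pow, ENNReal.mul_inv_cancel h0 enorm_ne_top, one_pow,
    one_mul]

/-- A block of a state can be replaced by one with real eigenfunctions, the same `n`-particle
density, and no more kinetic energy. -/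
theorem exists_real_block {n : ℕ} {Γ : fermionSpace n →L[ℂ] fermionSpace n}
    (S : SpectralDecomposition Γ) (htr : S.trace ≠ ∞) (hkin : S.traceForm kineticForm ≠ ∞) :
    ∃ (Γ' : fermionSpace n →L[ℂ] fermionSpace n) (S' : SpectralDecomposition Γ'),
      (∀ j, ∃ f, (S'.Ψ j : L2 n) = complexify f) ∧
      (∀ j p a, ∃ g, weakPartial (S'.Ψ j : L2 n) p a = complexify g) ∧
      (∀ᵐ X : Config n, ∑' j, (S'.μ j : ℝ≥0∞) * ‖(S'.Ψ j : L2 n) X‖ₑ ^ 2 =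
        ∑' j, (S.μ j : ℝ≥0∞) * ‖(S.Ψ j : L2 n) X‖ₑ ^ 2) ∧
      S'.traceForm kineticForm ≤ S.traceForm kineticForm := by
  let Θ : S.J → L2 n := fun j => S.Ψ j
  let dΘ : Fin n → Fin 3 → S.J → L2 n := fun p a j => weakPartial (S.Ψ j) p a
  -- Finite kinetic energy thus makes each family of partial derivatives square-summable.
  have hkin' : S.traceForm kineticForm =
      ∑ p, ∑ a, ∑' k, ‖realFamily S.μ (dΘ p a) k‖ₑ ^ 2 := by
    simp only [SpectralDecomposition.traceForm, kineticForm, tsum_enorm_sq_realFamily, dΘ,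
      Finset.mul_sum]
    rw [Summable.tsum_finsetSum fun _ _ => ENNReal.summable]
    refine Finset.sum_congr rfl fun p _ => ?_
    rw [Summable.tsum_finsetSum fun _ _ => ENNReal.summable]
  have hv : Summable fun k => ‖realFamily S.μ Θ k‖ ^ 2 := by
    refine summable_norm_sq_of_tsum_enorm_sq_ne_top ?_
    rw [tsum_enorm_sq_realFamily]
    convert htr using 1
    refine tsum_congr fun j => ?_
    have : ‖Θ j‖ = 1 := S.orthonormal.1 j
    rw [← enorm_norm, this]; simp
  have hdv : ∀ p a, Summable fun k => ‖realFamily S.μ (dΘ p a) k‖ ^ 2 := by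
    intro p a
    refine summable_norm_sq_of_tsum_enorm_sq_ne_top ?_
    rw [hkin', ENNReal.sum_ne_top] at hkin
    exact ENNReal.sum_ne_top.1 (hkin p (Finset.mem_univ _)) a (Finset.mem_univ _)
  obtain ⟨I, _, Φ, D, h0, ho, hfer, hD, hs, hle, hae⟩ :=
    exists_orthogonal_family (realFamily S.μ Θ) (fun p a => realFamily S.μ (dΘ p a))
      (by
        rintro ⟨j, _ | _⟩ p a
        · exact (hasWeakDeriv_imPart ((S.memH1 j).hasWeakDeriv p a)).const_smul_realL2 _
        · exact (hasWeakDeriv_rePart ((S.memH1 j).hasWeakDeriv p a)).const_smul_realL2 _)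
      (by
        rintro ⟨j, _ | _⟩ <;> rw [realFamily, map_smul] <;>
          refine ((fermionSpace n).restrictScalars ℝ).smul_mem _ ?_
        · exact complexify_imPart_mem (S.Ψ j).2
        · exact complexify_rePart_mem (S.Ψ j).2)
      hv hdv
  obtain ⟨Γ', S', e, hμ, hΨ⟩ := exists_spectralDecomposition_of_orthogonal Φ D h0 ho hfer hD hs
  have hW : ∀ j p a, weakPartial (S'.Ψ j : L2 n) p a =
      complexify (‖Φ (e j)‖⁻¹ • D (e j) p a) := fun j p a => by
    rw [hΨ]
    exact weakPartial_eq (hasWeakDeriv_complexify ((hD (e j) p a).const_smul_realL2 _))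
  refine ⟨Γ', S', fun j => ⟨_, hΨ j⟩, fun j p a => ⟨_, hW j p a⟩, ?_, ?_⟩
  · have h1 : ∀ᵐ X : Config n, ∀ j, (S'.μ j : ℝ≥0∞) * ‖(S'.Ψ j : L2 n) X‖ₑ ^ 2 =
        ‖Φ (e j) X‖ₑ ^ 2 := by
      refine ae_all_iff.2 fun j => ?_
      filter_upwards [coeFn_complexify (‖Φ (e j)‖⁻¹ • Φ (e j)),
        Lp.coeFn_smul ‖Φ (e j)‖⁻¹ (Φ (e j))] with X h1 h2
      rw [hΨ, h1, h2, hμ, ← enorm_norm, Complex.norm_real, enorm_norm, Pi.smul_apply]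
      exact nnnorm_sq_mul_enorm_inv_smul_sq (h0 _) _
    filter_upwards [h1, hae, tsum_enorm_sq_realFamily_apply S.μ Θ] with X h1 h2 h3
    rw [tsum_congr h1, ← h3, ← h2]
    exact e.tsum_eq fun i => ‖Φ i X‖ₑ ^ 2
  · rw [hkin']
    refine le_trans (le_of_eq ?_)
      (Finset.sum_le_sum fun p _ => Finset.sum_le_sum fun a _ => hle p a)
    simp only [SpectralDecomposition.traceForm, kineticForm, Finset.mul_sum]
    rw [Summable.tsum_finsetSum fun _ _ => ENNReal.summable]
    refine Finset.sum_congr rfl fun p _ => ?_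
    rw [Summable.tsum_finsetSum fun _ _ => ENNReal.summable]
    refine Finset.sum_congr rfl fun a _ => ?_
    rw [← e.tsum_eq]
    refine tsum_congr fun j => ?_
    rw [hW, hμ, enorm_complexify]
    exact nnnorm_sq_mul_enorm_inv_smul_sq (h0 _) _

/-! ### Slices and quantities determined by the diagonal -/

section Slices

variable {n : ℕ}

theorem measurable_cons (x : Space) :
    Measurable fun Y : Config n => (Fin.cons x Y : Config (n + 1)) := by
  refine measurable_pi_iff.2 fun i => ?_
  refine Fin.cases ?_ (fun k => ?_) i
  · simp
  · simpa using measurable_pi_apply k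

/-- Fubini for null sets, after splitting off the first particle by a measure-preserving map. -/
theorem ae_ae_cons {p : Config (n + 1) → Prop} (h : ∀ᵐ X, p X) :
    ∀ᵐ x : Space, ∀ᵐ Y : Config n, p (Fin.cons x Y) := by
  have h1 := (volume_preserving_piFinSuccAbove (fun _ : Fin (n + 1) => Space) 0).symm
    |>.quasiMeasurePreserving.ae h
  have h2 := Measure.ae_ae_of_ae_prod h1
  filter_upwards [h2] with x hx
  filter_upwards [hx] with Y hY
  simpa [MeasurableEquiv.piFinSuccAbove, Fin.insertNthEquiv, Fin.insertNth_zero] using hY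

end Slices

theorem measurable_enorm_sq_coe {n : ℕ} (Ψ : L2 n) : Measurable fun X => ‖Ψ X‖ₑ ^ 2 :=
  (Lp.stronglyMeasurable Ψ).measurable.enorm.pow_const 2

theorem measurable_coulomb (n : ℕ) : Measurable fun X : Config n =>
    ∑ i : Fin n, ∑ k ∈ Finset.Ioi i, (edist (X i) (X k))⁻¹ := by
  refine Finset.measurable_sum _ fun i _ => Finset.measurable_sum _ fun k _ => ?_
  exact ((measurable_pi_apply i).edist (measurable_pi_apply k)).inv

namespace SpectralDecomposition

variable {n : ℕ} {Γ Γ' : fermionSpace n →L[ℂ] fermionSpace n}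

/-- The diagonal `∑ⱼ μⱼ |Ψⱼ(X)|²` of the integral kernel. -/
def diagonal (S : SpectralDecomposition Γ) (X : Config n) : ℝ≥0∞ :=
  ∑' j, (S.μ j : ℝ≥0∞) * ‖(S.Ψ j : L2 n) X‖ₑ ^ 2

theorem trace_eq_lintegral_diagonal (S : SpectralDecomposition Γ) :
    S.trace = ∫⁻ X, S.diagonal X := by
  simp only [diagonal]
  rw [lintegral_tsum fun j => ((measurable_enorm_sq_coe _).const_mul _).aemeasurable]
  refine tsum_congr fun j => ?_
  rw [lintegral_const_mul _ (measurable_enorm_sq_coe _), ← enorm_sq_eq_lintegral]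
  have : ‖(S.Ψ j : L2 n)‖ = 1 := S.orthonormal.1 j
  rw [← enorm_norm, this]
  simp

theorem traceForm_coulombForm (S : SpectralDecomposition Γ) :
    S.traceForm coulombForm = ∫⁻ X : Config n,
      (∑ i : Fin n, ∑ k ∈ Finset.Ioi i, (edist (X i) (X k))⁻¹) * S.diagonal X := by
  simp only [diagonal, ← ENNReal.tsum_mul_left]
  have hm : ∀ j, Measurable fun X : Config n =>
      (∑ i : Fin n, ∑ k ∈ Finset.Ioi i, (edist (X i) (X k))⁻¹) *
        ((S.μ j : ℝ≥0∞) * ‖(S.Ψ j : L2 n) X‖ₑ ^ 2) := fun j =>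
    (measurable_coulomb n).mul ((measurable_enorm_sq_coe _).const_mul _)
  rw [lintegral_tsum fun j => (hm j).aemeasurable]
  refine tsum_congr fun j => ?_
  have hm' : Measurable fun X : Config n =>
      (∑ i : Fin n, ∑ k ∈ Finset.Ioi i, (edist (X i) (X k))⁻¹) * ‖(S.Ψ j : L2 n) X‖ₑ ^ 2 :=
    (measurable_coulomb n).mul (measurable_enorm_sq_coe _)
  rw [coulombForm, ← lintegral_const_mul _ hm']
  refine lintegral_congr fun X => ?_
  ring

theorem traceForm_waveDensity {Γ : fermionSpace (n + 1) →L[ℂ] fermionSpace (n + 1)}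
    (S : SpectralDecomposition Γ) (x : Space) :
    S.traceForm (fun Ψ => waveDensity Ψ x) =
      (n + 1 : ℝ≥0∞) * ∫⁻ Y : Config n, S.diagonal (Fin.cons x Y) := by
  have hm : ∀ j, Measurable fun Y : Config n =>
      ‖(S.Ψ j : L2 (n + 1)) (Fin.cons x Y : Config (n + 1))‖ₑ ^ 2 := fun j =>
    (measurable_enorm_sq_coe _).comp (measurable_cons x)
  simp only [diagonal, traceForm, waveDensity]
  rw [lintegral_tsum fun j => ((hm j).const_mul _).aemeasurable, ← ENNReal.tsum_mul_left]
  refine tsum_congr fun j => ?_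
  rw [lintegral_const_mul _ (hm j)]
  ring

theorem traceForm_add (S : SpectralDecomposition Γ) (A B : L2 n → ℝ≥0∞) :
    S.traceForm (fun Ψ => A Ψ + B Ψ) = S.traceForm A + S.traceForm B := by
  simp only [traceForm, mul_add]
  exact ENNReal.tsum_add

variable {S : SpectralDecomposition Γ} {S' : SpectralDecomposition Γ'}

theorem trace_congr (h : S'.diagonal =ᵐ[volume] S.diagonal) : S'.trace = S.trace := by
  rw [trace_eq_lintegral_diagonal, trace_eq_lintegral_diagonal, lintegral_congr_ae h]

theorem traceForm_coulombForm_congr (h : S'.diagonal =ᵐ[volume] S.diagonal) :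
    S'.traceForm coulombForm = S.traceForm coulombForm := by
  rw [traceForm_coulombForm, traceForm_coulombForm]
  refine lintegral_congr_ae ?_
  filter_upwards [h] with X hX
  rw [hX]

theorem traceForm_waveDensity_congr (h : S'.diagonal =ᵐ[volume] S.diagonal) :
    ∀ᵐ x : Space, S'.traceForm (fun Ψ => waveDensity Ψ x) =
      S.traceForm fun Ψ => waveDensity Ψ x := by
  cases n with
  | zero => exact .of_forall fun x => by simp [traceForm, waveDensity]
  | succ n =>
    filter_upwards [ae_ae_cons h] with x hx
    rw [traceForm_waveDensity, traceForm_waveDensity, lintegral_congr_ae hx]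

end SpectralDecomposition

/-! ### Vanishing current and equality of the functionals -/

theorem waveCurrent_eq_zero {n : ℕ} {Ψ : L2 n} (hΨ : ∃ f, Ψ = complexify f)
    (hW : ∀ p a, ∃ g, weakPartial Ψ p a = complexify g) :
    ∀ᵐ x : Space, ∀ a, waveCurrent Ψ x a = 0 := by
  cases n with
  | zero => exact .of_forall fun x a => rfl
  | succ n =>
    obtain ⟨f, hf⟩ := hΨ
    refine ae_all_iff.2 fun a => ?_
    obtain ⟨g, hg⟩ := hW 0 a
    have h : ∀ᵐ X : Config (n + 1), (weakPartial Ψ 0 a X * star (Ψ X)).im = 0 := by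
      filter_upwards [coeFn_complexify f, coeFn_complexify g] with X h1 h2
      rw [hg, hf, h1, h2]
      simp
    filter_upwards [ae_ae_cons h] with x hx
    rw [waveCurrent, integral_congr_ae hx]
    simp

/-- Each state has a counterpart without paramagnetic current, with the same density and
interaction energy, and with no more kinetic energy. -/
theorem FockState.exists_current_eq_zero (Γ : FockState) :
    ∃ Γ' : FockState, Γ'.HasCurrent 0 ∧ (∀ᵐ x : Space, Γ'.density x = Γ.density x) ∧
      Γ'.kineticEnergy ≤ Γ.kineticEnergy ∧ Γ'.energy ≤ Γ.energy := by
  have htr : ∀ n, (Γ.spec n).trace ≠ ∞ := fun n =>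
    ((ENNReal.le_tsum n).trans_lt (Γ.trace_eq_one ▸ ENNReal.one_lt_top)).ne
  have hkin : ∀ n, (Γ.spec n).traceForm kineticForm ≠ ∞ := fun n =>
    ((ENNReal.le_tsum n).trans_lt Γ.kinetic_lt_top).ne
  choose op S hre hW hdiag hle using fun n => exists_real_block (Γ.spec n) (htr n) (hkin n)
  have hd : ∀ n, (S n).diagonal =ᵐ[volume] (Γ.spec n).diagonal := hdiag
  refine ⟨⟨op, S, ?_, (ENNReal.tsum_le_tsum hle).trans_lt Γ.kinetic_lt_top⟩, ?_, ?_,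
    ENNReal.tsum_le_tsum hle, ENNReal.tsum_le_tsum fun n => ?_⟩
  · rw [← Γ.trace_eq_one]
    exact tsum_congr fun n => SpectralDecomposition.trace_congr (hd n)
  · have h : ∀ᵐ x : Space, ∀ n, ∀ j, ∀ a, waveCurrent ((S n).Ψ j : L2 n) x a = 0 :=
      ae_all_iff.2 fun n => ae_all_iff.2 fun j => waveCurrent_eq_zero (hre n j) (hW n j)
    filter_upwards [h] with x hx
    ext a
    simp [FockState.current, hx]
  · filter_upwards [ae_all_iff.2 fun n =>
      SpectralDecomposition.traceForm_waveDensity_congr (hd n)] with x hx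
    exact tsum_congr hx
  · simp only [SpectralDecomposition.traceForm_add]
    rw [SpectralDecomposition.traceForm_coulombForm_congr (hd n)]
    exact add_le_add_left (hle n) _

/-- A constraint can only raise the infimum; conversely, each competitor `Γ` is beaten or matched by
its current-free replacement. -/
theorem iInf_hasCurrent_zero_eq (ρ : Space → ℝ) (A : FockState → ℝ≥0∞)
    (hA : ∀ Γ : FockState, ∃ Γ' : FockState, Γ'.HasCurrent 0 ∧
      (∀ᵐ x : Space, Γ'.density x = Γ.density x) ∧ A Γ' ≤ A Γ) :
    ⨅ (Γ : FockState) (_ : Γ.HasDensity ρ) (_ : Γ.HasCurrent 0), A Γ =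
      ⨅ (Γ : FockState) (_ : Γ.HasDensity ρ), A Γ := by
  refine le_antisymm (le_iInf₂ fun Γ hΓ => ?_)
    (le_iInf fun Γ => le_iInf₂ fun hΓ _ => iInf₂_le Γ hΓ)
  obtain ⟨Γ', hj, hd, hle⟩ := hA Γ
  refine le_trans (iInf_le_of_le Γ' (iInf₂_le ?_ hj)) hle
  filter_upwards [hd, hΓ] with x h1 h2
  rw [h1, h2]

theorem TCurrent_zero (ρ : Space → ℝ) : TCurrent ρ 0 = TDensity ρ :=
  iInf_hasCurrent_zero_eq ρ _ fun Γ =>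
    let ⟨Γ', h1, h2, h3, _⟩ := Γ.exists_current_eq_zero
    ⟨Γ', h1, h2, h3⟩

theorem FCurrent_zero (ρ : Space → ℝ) : FCurrent ρ 0 = FDensity ρ :=
  iInf_hasCurrent_zero_eq ρ _ fun Γ =>
    let ⟨Γ', h1, h2, _, h3⟩ := Γ.exists_current_eq_zero
    ⟨Γ', h1, h2, h3⟩

end CurrentDFT

end

theorem proposition2p5 (ρ : CurrentDFT.Space → ℝ) (hρ : ρ ∈ CurrentDFT.densities) :
    CurrentDFT.TCurrent ρ 0 = CurrentDFT.TDensity ρ ∧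
    CurrentDFT.FCurrent ρ 0 = CurrentDFT.FDensity ρ ∧
    CurrentDFT.ECurrent ρ 0 = CurrentDFT.EDensity ρ ∧
    CurrentDFT.ExcCurrent ρ 0 = CurrentDFT.ExcDensity ρ := by
  have hT := CurrentDFT.TCurrent_zero ρ
  have hF := CurrentDFT.FCurrent_zero ρ
  have hE : CurrentDFT.ECurrent ρ 0 = CurrentDFT.EDensity ρ := by
    rw [CurrentDFT.ECurrent, CurrentDFT.EDensity, hF]
  refine ⟨hT, hF, hE, ?_⟩
  rw [CurrentDFT.ExcCurrent, CurrentDFT.ExcDensity, hE, hT]
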